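/- Let $n$ be a natural number and let $\Sigma,\Sigma'\in\mathbb{R}^{n\times n}$ be (symmetric) positive definite matrices. Let $G_\Sigma$ denote the Gaussian distribution on $\mathbb{R}^n$ with zero mean and covariance matrix $\Sigma$. For a permutation $\sigma\in\mathfrak{S}_n$ and $\boldsymbol{x}\in\mathbb{R}^n$ write $\boldsymbol{x}_\sigma=(x_{\sigma(1)},\dots,x_{\sigma(n)})$. Call two matrices $A,B\in\mathbb{R}^{n\times n}$ permutationally similar if $B=PAP^\top$ for some permutation matrix $P$. Then the following statements are equivalent: 1. The distributions $G_\Sigma$ and $G_{\Sigma'}$ are isomorphic, that is, there is $\sigma\in\mathfrak{S}_n$ such that $G_{\Sigma'}$ is the image of $G_\Sigma$ under the coordinate permutation $\boldsymbol{x}\mapsto\boldsymbol{x}_\sigma$. 2. The matrices $\Sigma$ and $\Sigma'$ are permutationally similar. 3. The matrices $\Sigma^{-1}$ and $(\Sigma')^{-1}$ are permutationally similar. 4. For each homogeneous symmetric polynomial $p\in\mathbb{R}[x_1,\dots,x_n]$ of even degree, the expected value of $p(\boldsymbol{x})$ is the same for $G_\Sigma$ and $G_{\Sigma'}$. 5.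 The symmetrized moments of $G_\Sigma$ and $G_{\Sigma'}$ are the same: for every $\boldsymbol{m}=(m_1,\dots,m_n)\in\mathbb{Z}_{\ge 0}^n$, the moments $\mathbb{E}[X_1^{m_1}\cdots X_n^{m_n}]$ under $H_\Sigma$ and under $H_{\Sigma'}$ are equal, where $H_\Sigma$ is the average of the images of $G_\Sigma$ under the $n!$ coordinate permutations $\boldsymbol{x}\mapsto\boldsymbol{x}_\sigma$, $\sigma\in\mathfrak{S}_n$. -/

import Mathlib

open MeasureTheory ProbabilityTheory

noncomputable section

/-- Two square matrices are permutationally similar if `B = P A Pᵀ` for a permutation matrix `P`. -/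
def PermSimilar {n : ℕ} (A B : Matrix (Fin n) (Fin n) ℝ) : Prop :=
  ∃ σ : Equiv.Perm (Fin n), B = σ.permMatrix ℝ * A * (σ.permMatrix ℝ).transpose

/-- The coordinate permutation `x ↦ x_σ = (x_{σ(1)}, …, x_{σ(n)})` of `ℝⁿ`. -/
def permCoords {n : ℕ} (σ : Equiv.Perm (Fin n)) (x : EuclideanSpace ℝ (Fin n)) :
    EuclideanSpace ℝ (Fin n) :=
  WithLp.toLp 2 (fun i => x (σ i))

theorem measurable_permCoords {n : ℕ} (σ : Equiv.Perm (Fin n)) : Measurable (permCoords σ) := by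
  unfold permCoords
  fun_prop

/-- Two distributions on `ℝⁿ` are isomorphic if a coordinate permutation carries one to the
other. -/
def IsomorphicDistributions {n : ℕ} (μ ν : Measure (EuclideanSpace ℝ (Fin n))) : Prop :=
  ∃ σ : Equiv.Perm (Fin n), μ.map (permCoords σ) = ν

/-- The Gaussian distribution on `ℝⁿ` with zero mean and covariance matrix `S`. -/
def centeredGaussian {n : ℕ} (S : Matrix (Fin n) (Fin n) ℝ) :
    Measure (EuclideanSpace ℝ (Fin n)) :=
  multivariateGaussian 0 S

/-- The symmetrization of a distribution on `ℝⁿ`: the average of its images under all `n!`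
coordinate permutations. -/
def symmetrizedDistribution {n : ℕ} (μ : Measure (EuclideanSpace ℝ (Fin n))) :
    Measure (EuclideanSpace ℝ (Fin n)) :=
  (n.factorial : ENNReal)⁻¹ • ∑ σ : Equiv.Perm (Fin n), μ.map (permCoords σ)

/-- The moment `𝔼[X₁^{m₁} ⋯ Xₙ^{mₙ}]` of a distribution on `ℝⁿ`. -/
def mixedMoment {n : ℕ} (μ : Measure (EuclideanSpace ℝ (Fin n))) (m : Fin n → ℕ) : ℝ :=
  ∫ x, ∏ i, x i ^ m i ∂μ

/-- The symmetrized moments of a distribution: the moments of its symmetrization. -/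
def symmetrizedMoment {n : ℕ} (μ : Measure (EuclideanSpace ℝ (Fin n))) (m : Fin n → ℕ) : ℝ :=
  mixedMoment (symmetrizedDistribution μ) m

end

/-!
A centered Gaussian is determined by its quadratic form `q_S(t) = tᵀ S t`, the variance of `⟨t, x⟩`,
and permuting the coordinates by `σ` replaces `S` by the matrix `S^σ` with entries `S_{σ(i)σ(j)}`.
Integrating the symmetrization of the polynomial `⟨t, x⟩^{2k}` yields `c_k ∑_σ q_{S^σ}(t)^k`, where
`c_k > 0` is a moment of the standard normal distribution. If the expectations of symmetric
polynomials of even degree agree, then for each `t` the values `q_{S^σ}(t)` and `q_{S'^σ}(t)` have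
the same power sums, so that `q_{S'}(t) = q_{S^σ}(t)` for some `σ`. A priori `σ` depends on `t`;
but `∏_σ (q_{S'} - q_{S^σ})` vanishes identically, and since polynomials form an integral domain, a
single `σ` works for all `t`.
-/

section PowerSums

theorem exists_eq_of_sum_pow_eq {R ι κ : Type*} [CommRing R] [LinearOrder R] [IsStrictOrderedRing R]
    [Fintype ι] [Fintype κ] {a : ι → R} {b : κ → R} (h : ∀ k : ℕ, ∑ i, a i ^ k = ∑ j, b j ^ k)
    (j : κ) : ∃ i, b j = a i := by
  have sum_eval_eq (f : Polynomial R) : ∑ i, f.eval (a i) = ∑ j, f.eval (b j) := by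
    simp only [Polynomial.eval_eq_sum_range]
    rw [Finset.sum_comm, Finset.sum_comm (s := Finset.univ)]
    simp only [← Finset.mul_sum, h]
  -- Test against `∏ (X - aᵢ)²`, which vanishes at every `aᵢ` and is nonnegative at every `bⱼ`.
  have hsum : ∑ j, ∏ i, (b j - a i) ^ 2 = 0 := by
    have := sum_eval_eq (∏ i, (Polynomial.X - Polynomial.C (a i)) ^ 2)
    simp only [Polynomial.eval_prod, Polynomial.eval_pow, Polynomial.eval_sub, Polynomial.eval_X,
      Polynomial.eval_C] at this
    rw [← this]
    exact Finset.sum_eq_zero fun i _ => Finset.prod_eq_zero (Finset.mem_univ i) (by simp)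
  have hprod : ∏ i, (b j - a i) ^ 2 = 0 :=
    (Finset.sum_eq_zero_iff_of_nonneg fun _ _ => Finset.prod_nonneg fun _ _ => sq_nonneg _).1
      hsum j (Finset.mem_univ j)
  obtain ⟨i, -, hi⟩ := Finset.prod_eq_zero_iff.1 hprod
  exact ⟨i, sub_eq_zero.1 (pow_eq_zero_iff two_ne_zero |>.1 hi)⟩

end PowerSums

section Polynomials

open Matrix MvPolynomial

variable {R ι : Type*}

theorem exists_eq_of_forall_exists_eval_eq {κ : Type*} [CommRing R] [IsDomain R] [Infinite R]
    [Finite κ] {p : κ → MvPolynomial ι R} {q : MvPolynomial ι R}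
    (h : ∀ x, ∃ j, eval x q = eval x (p j)) : ∃ j, q = p j := by
  have := Fintype.ofFinite κ
  have hprod : ∏ j, (q - p j) = 0 := by
    refine MvPolynomial.funext fun x => ?_
    obtain ⟨j, hj⟩ := h x
    rw [map_prod, map_zero]
    exact Finset.prod_eq_zero (Finset.mem_univ j) (by rw [map_sub, hj, sub_self])
  obtain ⟨j, -, hj⟩ := Finset.prod_eq_zero_iff.1 hprod
  exact ⟨j, sub_eq_zero.1 hj⟩

variable [Fintype ι] [CommSemiring R]

/-- The linear form `∑ tᵢ xᵢ` as a polynomial. -/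
noncomputable def linearForm (t : ι → R) : MvPolynomial ι R :=
  (fun i => C (t i)) ⬝ᵥ X

theorem eval_linearForm (t x : ι → R) : eval x (linearForm t) = t ⬝ᵥ x := by
  simp [linearForm, dotProduct]

theorem isHomogeneous_linearForm (t : ι → R) : (linearForm t).IsHomogeneous 1 :=
  IsHomogeneous.sum _ _ _ fun i _ => isHomogeneous_C_mul_X (t i) i

/-- The quadratic form `∑ Aᵢⱼ xᵢ xⱼ` of a matrix as a polynomial. -/
noncomputable def quadraticPolynomial (A : Matrix ι ι R) : MvPolynomial ι R :=
  X ⬝ᵥ A.map C *ᵥ X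

theorem eval_quadraticPolynomial (A : Matrix ι ι R) (x : ι → R) :
    eval x (quadraticPolynomial A) = x ⬝ᵥ A *ᵥ x := by
  simp [quadraticPolynomial, dotProduct, mulVec]

variable [DecidableEq ι]

/-- The symmetrization of a polynomial: the sum, without normalization, of its images under all
permutations of the variables. -/
noncomputable def symmetrizedPolynomial (p : MvPolynomial ι R) : MvPolynomial ι R :=
  ∑ σ : Equiv.Perm ι, rename σ p

theorem isSymmetric_symmetrizedPolynomial (p : MvPolynomial ι R) :
    (symmetrizedPolynomial p).IsSymmetric := by
  intro τ
  rw [symmetrizedPolynomial, map_sum]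
  exact Fintype.sum_equiv (Equiv.mulLeft τ) _ _ fun σ => rename_rename _ _ p

theorem isHomogeneous_symmetrizedPolynomial {p : MvPolynomial ι R} {k : ℕ}
    (hp : p.IsHomogeneous k) : (symmetrizedPolynomial p).IsHomogeneous k :=
  IsHomogeneous.sum _ _ _ fun _ _ => hp.rename_isHomogeneous

theorem symmetrizedPolynomial_of_isSymmetric {p : MvPolynomial ι R} (hp : p.IsSymmetric) :
    symmetrizedPolynomial p = (Fintype.card ι).factorial • p := by
  simp only [symmetrizedPolynomial, hp _, Finset.sum_const, Finset.card_univ, Fintype.card_perm]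

end Polynomials

section PermSimilar

open Matrix

variable {n : ℕ} {A B : Matrix (Fin n) (Fin n) ℝ}

theorem permSimilar_iff_exists_submatrix :
    PermSimilar A B ↔ ∃ σ : Equiv.Perm (Fin n), B = A.submatrix σ σ := by
  refine exists_congr fun σ => ?_
  rw [PEquiv.toMatrix_toPEquiv_mul, transpose_permMatrix, PEquiv.mul_toMatrix_toPEquiv]
  rfl

theorem PermSimilar.inv (h : PermSimilar A B) : PermSimilar A⁻¹ B⁻¹ := by
  obtain ⟨σ, rfl⟩ := permSimilar_iff_exists_submatrix.1 h
  exact permSimilar_iff_exists_submatrix.2 ⟨σ, inv_submatrix_equiv A σ σ⟩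

theorem permSimilar_inv_iff (hA : IsUnit A.det) (hB : IsUnit B.det) :
    PermSimilar A⁻¹ B⁻¹ ↔ PermSimilar A B := by
  refine ⟨fun h => ?_, PermSimilar.inv⟩
  simpa only [nonsing_inv_nonsing_inv A hA, nonsing_inv_nonsing_inv B hB] using h.inv

end PermSimilar

section Symmetrization

open MvPolynomial

variable {n : ℕ} {μ ν : Measure (EuclideanSpace ℝ (Fin n))}

theorem permCoords_comp_permCoords (σ τ : Equiv.Perm (Fin n)) :
    permCoords τ ∘ permCoords σ = permCoords (σ * τ) :=
  rfl

theorem symmetrizedDistribution_map_permCoords (μ : Measure (EuclideanSpace ℝ (Fin n)))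
    (σ : Equiv.Perm (Fin n)) :
    symmetrizedDistribution (μ.map (permCoords σ)) = symmetrizedDistribution μ := by
  simp only [symmetrizedDistribution,
    Measure.map_map (measurable_permCoords _) (measurable_permCoords σ), permCoords_comp_permCoords]
  congr 1
  exact Equiv.sum_comp (Equiv.mulLeft σ) fun τ => μ.map (permCoords τ)

theorem IsomorphicDistributions.symmetrizedDistribution_eq (h : IsomorphicDistributions μ ν) :
    symmetrizedDistribution μ = symmetrizedDistribution ν := by
  obtain ⟨σ, rfl⟩ := h
  exact (symmetrizedDistribution_map_permCoords μ σ).symm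

theorem measurable_eval_euclideanSpace (p : MvPolynomial (Fin n) ℝ) :
    Measurable fun x : EuclideanSpace ℝ (Fin n) => eval x p :=
  ((continuous_eval p).comp (PiLp.continuous_ofLp 2 _)).measurable

theorem integral_eval_map_permCoords (μ : Measure (EuclideanSpace ℝ (Fin n)))
    (σ : Equiv.Perm (Fin n)) (p : MvPolynomial (Fin n) ℝ) :
    ∫ x, eval x p ∂μ.map (permCoords σ) = ∫ x, eval x (rename σ p) ∂μ := by
  rw [integral_map (measurable_permCoords σ).aemeasurable
    (measurable_eval_euclideanSpace p).aestronglyMeasurable]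
  simp only [eval_rename]
  rfl

/-- A distribution on `ℝⁿ` has finite moments if all monomials are integrable, so that none of its
mixed moments is a junk value. -/
def HasFiniteMoments (μ : Measure (EuclideanSpace ℝ (Fin n))) : Prop :=
  ∀ m : Fin n → ℕ, Integrable (fun x : EuclideanSpace ℝ (Fin n) => ∏ i, x i ^ m i) μ

namespace HasFiniteMoments

theorem integrable_eval (hμ : HasFiniteMoments μ) (p : MvPolynomial (Fin n) ℝ) :
    Integrable (fun x : EuclideanSpace ℝ (Fin n) => eval x p) μ := by
  simp only [eval_eq']
  exact integrable_finsetSum _ fun d _ => (hμ d).const_mul _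

theorem integral_eval (hμ : HasFiniteMoments μ) (p : MvPolynomial (Fin n) ℝ) :
    ∫ x, eval x p ∂μ = ∑ d ∈ p.support, p.coeff d * mixedMoment μ d := by
  simp only [eval_eq', mixedMoment]
  rw [integral_finsetSum]
  · simp only [integral_const_mul]
  · exact fun d _ => (hμ d).const_mul _

theorem map_permCoords (hμ : HasFiniteMoments μ) (σ : Equiv.Perm (Fin n)) :
    HasFiniteMoments (μ.map (permCoords σ)) := by
  intro m
  rw [integrable_map_measure (Measurable.aestronglyMeasurable (by fun_prop))
    (measurable_permCoords σ).aemeasurable]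
  refine (hμ (m ∘ σ.symm)).congr (.of_forall fun x => ?_)
  exact (Fintype.prod_equiv σ _ _ fun i => by simp [permCoords]).symm

theorem symmetrized (hμ : HasFiniteMoments μ) :
    HasFiniteMoments (symmetrizedDistribution μ) := fun m =>
  (integrable_finsetSum_measure.2 fun σ _ => hμ.map_permCoords σ m).smul_measure
    (by simp [Nat.factorial_ne_zero])

theorem integral_eval_symmetrizedPolynomial (hμ : HasFiniteMoments μ)
    (p : MvPolynomial (Fin n) ℝ) :
    ∫ x, eval x (symmetrizedPolynomial p) ∂μ =
      ∑ σ : Equiv.Perm (Fin n), ∫ x, eval x p ∂μ.map (permCoords σ) := by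
  simp only [symmetrizedPolynomial, map_sum, integral_eval_map_permCoords]
  exact integral_finsetSum _ fun σ _ => hμ.integrable_eval _

theorem integral_eval_symmetrizedDistribution (hμ : HasFiniteMoments μ)
    {p : MvPolynomial (Fin n) ℝ} (hp : p.IsSymmetric) :
    ∫ x, eval x p ∂symmetrizedDistribution μ = ∫ x, eval x p ∂μ := by
  have hn : (n.factorial : ℝ) ≠ 0 := Nat.cast_ne_zero.2 n.factorial_ne_zero
  calc ∫ x, eval x p ∂symmetrizedDistribution μ
      = (n.factorial : ℝ)⁻¹ * ∑ σ : Equiv.Perm (Fin n), ∫ x, eval x p ∂μ.map (permCoords σ) := by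
        rw [symmetrizedDistribution, integral_smul_measure,
          integral_finsetSum_measure fun σ _ => (hμ.map_permCoords σ).integrable_eval p]
        simp
    _ = (n.factorial : ℝ)⁻¹ * ∫ x, eval x (symmetrizedPolynomial p) ∂μ := by
        rw [hμ.integral_eval_symmetrizedPolynomial]
    _ = (n.factorial : ℝ)⁻¹ * (n.factorial * ∫ x, eval x p ∂μ) := by
        simp only [symmetrizedPolynomial_of_isSymmetric hp, Fintype.card_fin, nsmul_eq_mul,
          map_mul, map_natCast, integral_const_mul]
    _ = ∫ x, eval x p ∂μ := inv_mul_cancel_left₀ hn _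

end HasFiniteMoments

theorem integral_eval_eq_of_symmetrizedMoment_eq (hμ : HasFiniteMoments μ)
    (hν : HasFiniteMoments ν) (h : ∀ m, symmetrizedMoment μ m = symmetrizedMoment ν m)
    {p : MvPolynomial (Fin n) ℝ} (hp : p.IsSymmetric) :
    ∫ x, eval x p ∂μ = ∫ x, eval x p ∂ν := by
  rw [← hμ.integral_eval_symmetrizedDistribution hp, ← hν.integral_eval_symmetrizedDistribution hp,
    hμ.symmetrized.integral_eval, hν.symmetrized.integral_eval]
  exact Finset.sum_congr rfl fun d _ => congrArg _ (h d)

end Symmetrization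

section GaussianMoments

theorem moment_id_gaussianReal_pos {m : ℝ} {v : NNReal} (hv : v ≠ 0) {k : ℕ} (hk : Even k) :
    0 < moment id k (gaussianReal m v) := by
  have hint : Integrable (fun x : ℝ => x ^ k) (gaussianReal m v) := by
    have h := (memLp_id_gaussianReal' (μ := m) (v := v) k
      (ENNReal.natCast_ne_top _)).integrable_norm_pow'
    simpa only [id, Real.norm_eq_abs, hk.pow_abs] using h
  have := nullSingletonClass_gaussianReal (μ := m) hv
  refine (integral_pos_iff_support_of_nonneg (fun x => hk.pow_nonneg x) hint).2 ?_
  calc (0 : ENNReal) < gaussianReal m v {0}ᶜ := by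
        rw [prob_compl_eq_one_sub (measurableSet_singleton 0), measure_singleton]
        simp
    _ ≤ _ := measure_mono fun x hx => pow_ne_zero k hx

theorem moment_id_gaussianReal_zero (v : NNReal) (k : ℕ) :
    moment id k (gaussianReal 0 v) = √v ^ k * moment id k (gaussianReal 0 1) := by
  have hmap : (gaussianReal 0 1).map (√v * ·) = gaussianReal 0 v := by
    rw [gaussianReal_map_const_mul]
    congr 1
    · simp
    · ext
      simp
  rw [← hmap]
  simp only [moment, Pi.pow_apply, id]
  rw [integral_map (by fun_prop) (by fun_prop)]
  simp only [mul_pow, integral_const_mul]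

theorem moment_dual_of_isGaussian {E : Type*} [NormedAddCommGroup E] [NormedSpace ℝ E]
    [MeasurableSpace E] [BorelSpace E] {μ : Measure E} [IsGaussian μ] {L : StrongDual ℝ E}
    (hL : μ[L] = 0) (k : ℕ) :
    moment L k μ = √Var[L; μ] ^ k * moment id k (gaussianReal 0 1) := by
  have hmap : μ.map L = gaussianReal 0 Var[L; μ].toNNReal := by
    rw [IsGaussian.map_eq_gaussianReal, hL]
  calc moment L k μ = moment id k (μ.map L) :=
        (integral_map (f := fun y : ℝ => y ^ k) (by fun_prop) (by fun_prop)).symm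
    _ = √Var[L; μ] ^ k * moment id k (gaussianReal 0 1) := by
        rw [hmap, moment_id_gaussianReal_zero, Real.coe_toNNReal _ (variance_nonneg _ _)]

theorem hasFiniteMoments_of_isGaussian {n : ℕ} (μ : Measure (EuclideanSpace ℝ (Fin n)))
    [IsGaussian μ] : HasFiniteMoments μ := by
  intro m
  have h := (IsGaussian.memLp_id μ (∑ i, m i : ℕ) (by simp)).integrable_norm_pow'
  refine h.mono' (Measurable.aestronglyMeasurable (by fun_prop)) (.of_forall fun x => ?_)
  calc ‖∏ i, x i ^ m i‖ = ∏ i, ‖x i‖ ^ m i := by simp only [norm_prod, norm_pow]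
    _ ≤ ∏ i, ‖x‖ ^ m i := by
        gcongr with i
        exact PiLp.norm_apply_le x i
    _ = ‖x‖ ^ ∑ i, m i := Finset.prod_pow_eq_pow_sum _ _ _

end GaussianMoments

section CenteredGaussian

open Matrix MvPolynomial

variable {n : ℕ} {S S' : Matrix (Fin n) (Fin n) ℝ}

instance isGaussian_centeredGaussian (S : Matrix (Fin n) (Fin n) ℝ) :
    IsGaussian (centeredGaussian S) :=
  isGaussian_multivariateGaussian

theorem charFun_centeredGaussian (hS : S.PosSemidef) (t : EuclideanSpace ℝ (Fin n)) :
    charFun (centeredGaussian S) t = Complex.exp (-((t ⬝ᵥ S *ᵥ t : ℝ) : ℂ) / 2) := by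
  rw [centeredGaussian, charFun_multivariateGaussian hS]
  simp [neg_div]

theorem centeredGaussian_eq_of_quadraticForm_eq (hS : S.PosSemidef) (hS' : S'.PosSemidef)
    (h : ∀ t : Fin n → ℝ, t ⬝ᵥ S *ᵥ t = t ⬝ᵥ S' *ᵥ t) :
    centeredGaussian S = centeredGaussian S' := by
  refine Measure.ext_of_charFun (funext fun t => ?_)
  rw [charFun_centeredGaussian hS, charFun_centeredGaussian hS', h]

theorem centeredGaussian_eq_iff (hS : S.PosSemidef) (hS' : S'.PosSemidef) :
    centeredGaussian S = centeredGaussian S' ↔ S = S' := by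
  refine ⟨fun h => ?_, congrArg _⟩
  ext i j
  rw [← covariance_eval_multivariateGaussian (μ := 0) hS i j,
    ← covariance_eval_multivariateGaussian (μ := 0) hS' i j]
  exact congrArg (fun μ => cov[fun x => x i, fun x => x j; μ]) h

theorem inner_permCoords_left (σ : Equiv.Perm (Fin n)) (x t : EuclideanSpace ℝ (Fin n)) :
    inner ℝ (permCoords σ x) t = inner ℝ x (permCoords σ⁻¹ t) := by
  simp only [PiLp.inner_apply, permCoords]
  exact Fintype.sum_equiv σ _ _ fun i => by simp

theorem permCoords_inv_dotProduct_mulVec (S : Matrix (Fin n) (Fin n) ℝ) (σ : Equiv.Perm (Fin n))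
    (t : EuclideanSpace ℝ (Fin n)) :
    permCoords σ⁻¹ t ⬝ᵥ S *ᵥ permCoords σ⁻¹ t = t ⬝ᵥ S.submatrix σ σ *ᵥ t := by
  rw [submatrix_mulVec_equiv, ← comp_equiv_symm_dotProduct]
  rfl

theorem map_permCoords_centeredGaussian (hS : S.PosSemidef) (σ : Equiv.Perm (Fin n)) :
    (centeredGaussian S).map (permCoords σ) = centeredGaussian (S.submatrix σ σ) := by
  have : IsProbabilityMeasure ((centeredGaussian S).map (permCoords σ)) :=
    Measure.isProbabilityMeasure_map (measurable_permCoords σ).aemeasurable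
  refine Measure.ext_of_charFun (funext fun t => ?_)
  calc charFun ((centeredGaussian S).map (permCoords σ)) t
      = charFun (centeredGaussian S) (permCoords σ⁻¹ t) := by
        rw [charFun_apply, charFun_apply, integral_map (measurable_permCoords σ).aemeasurable
          (Measurable.aestronglyMeasurable (by fun_prop))]
        simp only [inner_permCoords_left]
    _ = charFun (centeredGaussian (S.submatrix σ σ)) t := by
        rw [charFun_centeredGaussian hS, charFun_centeredGaussian (hS.submatrix σ),
          permCoords_inv_dotProduct_mulVec]

theorem isomorphicDistributions_centeredGaussian_iff (hS : S.PosSemidef) (hS' : S'.PosSemidef) :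
    IsomorphicDistributions (centeredGaussian S) (centeredGaussian S') ↔ PermSimilar S S' := by
  rw [permSimilar_iff_exists_submatrix]
  refine exists_congr fun σ => ?_
  rw [map_permCoords_centeredGaussian hS, centeredGaussian_eq_iff (hS.submatrix σ) hS', eq_comm]

theorem integral_eval_linearForm_pow_centeredGaussian (hS : S.PosSemidef) (t : Fin n → ℝ) (k : ℕ) :
    ∫ x, eval x (linearForm t ^ (2 * k)) ∂centeredGaussian S =
      (t ⬝ᵥ S *ᵥ t) ^ k * moment id (2 * k) (gaussianReal 0 1) := by
  set L : StrongDual ℝ (EuclideanSpace ℝ (Fin n)) := innerSL ℝ (WithLp.toLp 2 t) with hL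
  have hmean : (centeredGaussian S)[L] = 0 := by
    rw [IsGaussian.integral_dual, centeredGaussian, integral_id_multivariateGaussian, map_zero]
  have hvar : Var[L; centeredGaussian S] = t ⬝ᵥ S *ᵥ t :=
    (covarianceBilin_self IsGaussian.memLp_two_id _).symm.trans
      (covarianceBilin_multivariateGaussian hS _ _)
  have heval (x : EuclideanSpace ℝ (Fin n)) : eval x (linearForm t) = L x := by
    simp [eval_linearForm, hL, PiLp.inner_apply, dotProduct, mul_comm]
  calc ∫ x, eval x (linearForm t ^ (2 * k)) ∂centeredGaussian S
      = moment L (2 * k) (centeredGaussian S) := by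
        simp only [map_pow, heval, moment, Pi.pow_apply]
    _ = (t ⬝ᵥ S *ᵥ t) ^ k * moment id (2 * k) (gaussianReal 0 1) := by
        rw [moment_dual_of_isGaussian hmean, pow_mul, Real.sq_sqrt (variance_nonneg _ _), hvar]

theorem integral_eval_symmetrizedPolynomial_linearForm_pow (hS : S.PosSemidef) (t : Fin n → ℝ)
    (k : ℕ) :
    ∫ x, eval x (symmetrizedPolynomial (linearForm t ^ (2 * k))) ∂centeredGaussian S =
      (∑ σ : Equiv.Perm (Fin n), (t ⬝ᵥ S.submatrix σ σ *ᵥ t) ^ k) *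
        moment id (2 * k) (gaussianReal 0 1) := by
  rw [(hasFiniteMoments_of_isGaussian _).integral_eval_symmetrizedPolynomial, Finset.sum_mul]
  refine Finset.sum_congr rfl fun σ _ => ?_
  rw [map_permCoords_centeredGaussian hS,
    integral_eval_linearForm_pow_centeredGaussian (hS.submatrix σ)]

theorem sum_quadraticForm_pow_eq_of_integral_eval_eq (hS : S.PosSemidef) (hS' : S'.PosSemidef)
    (h : ∀ (k : ℕ) (p : MvPolynomial (Fin n) ℝ), Even k → p.IsHomogeneous k → p.IsSymmetric →
      ∫ x, eval x p ∂centeredGaussian S = ∫ x, eval x p ∂centeredGaussian S')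
    (t : Fin n → ℝ) (k : ℕ) :
    ∑ σ : Equiv.Perm (Fin n), (t ⬝ᵥ S.submatrix σ σ *ᵥ t) ^ k =
      ∑ σ : Equiv.Perm (Fin n), (t ⬝ᵥ S'.submatrix σ σ *ᵥ t) ^ k := by
  have hhom : (linearForm t ^ (2 * k)).IsHomogeneous (2 * k) := by
    simpa only [one_mul] using (isHomogeneous_linearForm t).pow (2 * k)
  have hint := h (2 * k) _ (even_two_mul k) (isHomogeneous_symmetrizedPolynomial hhom)
    (isSymmetric_symmetrizedPolynomial _)
  rw [integral_eval_symmetrizedPolynomial_linearForm_pow hS,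
    integral_eval_symmetrizedPolynomial_linearForm_pow hS'] at hint
  exact mul_right_cancel₀ (moment_id_gaussianReal_pos one_ne_zero (even_two_mul k)).ne' hint

theorem isomorphicDistributions_of_integral_eval_eq (hS : S.PosSemidef) (hS' : S'.PosSemidef)
    (h : ∀ (k : ℕ) (p : MvPolynomial (Fin n) ℝ), Even k → p.IsHomogeneous k → p.IsSymmetric →
      ∫ x, eval x p ∂centeredGaussian S = ∫ x, eval x p ∂centeredGaussian S') :
    IsomorphicDistributions (centeredGaussian S) (centeredGaussian S') := by
  have exists_perm_eval_eq (t : Fin n → ℝ) : ∃ σ : Equiv.Perm (Fin n),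
      eval t (quadraticPolynomial S') = eval t (quadraticPolynomial (S.submatrix σ σ)) := by
    simp only [eval_quadraticPolynomial]
    exact exists_eq_of_sum_pow_eq
      (b := fun σ : Equiv.Perm (Fin n) => t ⬝ᵥ S'.submatrix σ σ *ᵥ t)
      (sum_quadraticForm_pow_eq_of_integral_eval_eq hS hS' h t) 1
  obtain ⟨σ, hσ⟩ := exists_eq_of_forall_exists_eval_eq exists_perm_eval_eq
  refine ⟨σ, ?_⟩
  rw [map_permCoords_centeredGaussian hS]
  refine centeredGaussian_eq_of_quadraticForm_eq (hS.submatrix σ) hS' fun t => ?_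
  rw [← eval_quadraticPolynomial, ← eval_quadraticPolynomial, hσ]

end CenteredGaussian

theorem mainTheorem3_general (n : ℕ) (S S' : Matrix (Fin n) (Fin n) ℝ) (hS : S.PosSemidef)
    (hS' : S'.PosSemidef) :
    List.TFAE [
      IsomorphicDistributions (centeredGaussian S) (centeredGaussian S'),
      PermSimilar S S',
      ∀ (k : ℕ) (p : MvPolynomial (Fin n) ℝ), Even k → p.IsHomogeneous k → p.IsSymmetric →
        ∫ x, MvPolynomial.eval (fun i => x i) p ∂(centeredGaussian S) =
          ∫ x, MvPolynomial.eval (fun i => x i) p ∂(centeredGaussian S'),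
      ∀ m : Fin n → ℕ,
        symmetrizedMoment (centeredGaussian S) m = symmetrizedMoment (centeredGaussian S') m] := by
  tfae_have 1 ↔ 2 := isomorphicDistributions_centeredGaussian_iff hS hS'
  tfae_have 1 → 4 := fun h m => congrArg (mixedMoment · m) h.symmetrizedDistribution_eq
  tfae_have 4 → 3 := fun h _ _ _ _ hp => integral_eval_eq_of_symmetrizedMoment_eq
    (hasFiniteMoments_of_isGaussian _) (hasFiniteMoments_of_isGaussian _) h hp
  tfae_have 3 → 1 := isomorphicDistributions_of_integral_eval_eq hS hS'
  tfae_finish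

theorem mainTheorem3 (n : ℕ) (S S' : Matrix (Fin n) (Fin n) ℝ) (hS : S.PosDef) (hS' : S'.PosDef) :
    List.TFAE [
      IsomorphicDistributions (centeredGaussian S) (centeredGaussian S'),
      PermSimilar S S',
      PermSimilar S⁻¹ S'⁻¹,
      ∀ (k : ℕ) (p : MvPolynomial (Fin n) ℝ), Even k → p.IsHomogeneous k → p.IsSymmetric →
        ∫ x, MvPolynomial.eval (fun i => x i) p ∂(centeredGaussian S) =
          ∫ x, MvPolynomial.eval (fun i => x i) p ∂(centeredGaussian S'),
      ∀ m : Fin n → ℕ,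
        symmetrizedMoment (centeredGaussian S) m = symmetrizedMoment (centeredGaussian S') m] := by
  rw [permSimilar_inv_iff hS.det_pos.ne'.isUnit hS'.det_pos.ne'.isUnit]
  simpa only [List.tfae_cons_cons, iff_self, true_and] using
    mainTheorem3_general n S S' hS.posSemidef hS'.posSemidef
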